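/- Consider a loss system with $K\ge 1$ customer classes and two layers of servers: layer 1 contains $m_k\ge 0$ servers dedicated to class $k$, and layer 2 contains $n\ge 0$ servers capable of serving all classes. Class-$k$ customers arrive at rate $\lambda_k>0$ and have exponential service requirements with parameter $\mu_k>0$; an arriving class-$k$ customer is assigned to a vacant class-$k$ server in layer 1 if there is one, otherwise to a vacant server in layer 2 if there is one, and is otherwise rejected. Let $X_{i,k}(t)$ be the number of class-$k$ customers being served in layer $i$ at time $t$. Thus $X=(X_{i,k})$ is a continuous-time Markov process with right-continuous paths with left-hand limits in the finite set $$S_{m,n}=\Big\{x\in\mathbb Z_+^K\times\mathbb Z_+^K:\ x_{1,k}\le m_k\ \text{for all }k,\ \sum_{k}x_{2,k}\le n\Big\},$$ and it has the transitions $x\mapsto x+e_{1,k}$ at rate $\lambda_k 1(x_{1,k}<m_k)$, $x\mapsto x+e_{2,k}$ at rate $\lambda_k 1(x_{1,k}=m_k,\ \sum_l x_{2,l}<n)$, and $x\mapsto x-e_{i,k}$ at rate $\mu_k x_{i,k}$ ($i=1,2$), where $e_{i,k}$ are the unit vectors. Write $|x|=\sum_{i,k}x_{i,k}$. Fix a class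 $c$ (without loss of generality $c=1$) with $m_c\ge 1$, and let $Y$ be the corresponding process, with the same $\lambda$ and $\mu$, for the system in which one class-$c$ server of layer 1 has been moved to layer 2, that is, with $m'$ and $n'$ in place of $m$ and $n$, where $m'_c=m_c-1$, $m'_k=m_k$ for $k\ne c$, and $n'=n+1$. Assume that all service rates $\mu_k$ are equal. Let $X$ and $Y$ be defined on a common probability space, with arbitrary joint dependence, and suppose that their initial states satisfy $Y(0)-X(0)\in\Delta$ almost surely, where states are identified with the vectors $(x_{1,1},\dots,x_{1,K};x_2)$, $x_2=\sum_k x_{2,k}$, and $$\Delta=\{0,\ e_2,\ e_2-e_{1,c},\ 2e_2-e_{1,c}\}\subset\mathbb Z^K\times\mathbb Z,$$ with $e_2$ and $e_{1,c}$ here the unit vectors of $\mathbb Z^K\times\mathbb Z$ in the last and in the $c$-th coordinate direction. Then the processes $t\mapsto|X(t)|$ and $t\mapsto|Y(t)|$ of the total numbers of customers satisfy $|X|\le_{\rm st}|Y|$, that is, $\operatorname{E}\varphi(|X|)\le\operatorname{E}\varphi(|Y|)$ for every bounded measurable $\varphi:D(\mathbb R_+,\mathbb Z_+)\to\mathbb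 R$ that is increasing with respect to the pointwise order on the space $D(\mathbb R_+,\mathbb Z_+)$ of right-continuous functions with left-hand limits. -/

import Mathlib

open MeasureTheory Filter Topology
open scoped NNReal

namespace LossSystem

/-- Right-continuous functions on `[0, ∞)` with left-hand limits. -/
def IsCadlag {E : Type*} [TopologicalSpace E] (f : ℝ≥0 → E) : Prop :=
  ∀ t, ContinuousWithinAt f (Set.Ici t) t ∧ ∃ l, Tendsto f (𝓝[<] t) (𝓝 l)

/-- The path space `D(ℝ₊, E)`. As a subtype of `ℝ≥0 → E`, it carries the σ-algebra generated by the
evaluations `f ↦ f t` and, when `E` is ordered, the pointwise order. -/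
abbrev Path (E : Type*) [TopologicalSpace E] := {f : ℝ≥0 → E // IsCadlag f}

theorem IsCadlag.comp {E F : Type*} [TopologicalSpace E] [TopologicalSpace F] {g : E → F}
    (hg : Continuous g) {f : ℝ≥0 → E} (hf : IsCadlag f) : IsCadlag fun t => g (f t) := by
  intro t
  obtain ⟨h1, l, hl⟩ := hf t
  exact ⟨hg.continuousAt.comp_continuousWithinAt h1, g l, (hg.tendsto l).comp hl⟩

/-- The matrix of a family of jump rates `r x y` (the rate of the jump `x ↦ y`): off the diagonal
its entries are the rates, and its rows sum to zero. -/
def generator {S : Type*} [Fintype S] [DecidableEq S] (r : S → S → ℝ) : Matrix S S ℝ :=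
  Matrix.of fun x y => r x y - if x = y then ∑ z, r x z else 0

/-- `X` is a continuous-time Markov process on the finite set `S` with generator `Q` and paths in
`D(ℝ₊, S)`: it is a random element of the path space, and it is a time-homogeneous Markov process
with transition probabilities `p_t(x, y) = exp(t Q)(x, y)`, that is,
`P(X(t₀) = x₀, …, X(t_N) = x_N) = P(X(t₀) = x₀) ∏ p_{t_{i+1} - t_i}(x_i, x_{i+1})`
for all `t₀ ≤ ⋯ ≤ t_N`. The law of `X(0)` is arbitrary. -/
structure IsMarkovProcess {Ω S : Type*} [MeasurableSpace Ω] [Fintype S] [DecidableEq S]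
    [TopologicalSpace S] [MeasurableSpace S] (P : Measure Ω) (Q : Matrix S S ℝ)
    (X : Ω → Path S) : Prop where
  measurable : Measurable X
  markov : ∀ (N : ℕ) (t : ℕ → ℝ≥0) (x : ℕ → S), Monotone t →
    P.real {ω | ∀ i ≤ N, (X ω).1 (t i) = x i} =
      P.real {ω | (X ω).1 (t 0) = x 0} *
        ∏ i ∈ Finset.range N,
          NormedSpace.exp (((t (i + 1) : ℝ) - (t i : ℝ)) • Q) (x i) (x (i + 1))

/-- Stochastic order `U ≤_st V` of random elements of an ordered measurable space: every bounded
measurable increasing function has a smaller expectation under the law of `U`. -/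
def StochLE {Ω Ω' D : Type*} [MeasurableSpace Ω] [MeasurableSpace Ω'] [MeasurableSpace D]
    [Preorder D] (P : Measure Ω) (U : Ω → D) (P' : Measure Ω') (V : Ω' → D) : Prop :=
  ∀ φ : D → ℝ, Measurable φ → (∃ C, ∀ f, |φ f| ≤ C) → Monotone φ →
    ∫ ω, φ (U ω) ∂P ≤ ∫ ω, φ (V ω) ∂P'

variable {K : ℕ}

/-- The states of the system with `m k` servers dedicated to class `k` in layer 1 and `n` servers in
layer 2: `x i k` is the number of class-`k` customers served in layer `i + 1`
(index `0` is layer 1 and index `1` is layer 2). -/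
abbrev State (m : Fin K → ℕ) (n : ℕ) :=
  {x : Fin 2 → Fin K → ℕ // (∀ k, x 0 k ≤ m k) ∧ ∑ k, x 1 k ≤ n}

instance (m : Fin K → ℕ) (n : ℕ) : Finite (State m n) := by
  have h : {x : Fin 2 → Fin K → ℕ | (∀ k, x 0 k ≤ m k) ∧ ∑ k, x 1 k ≤ n}.Finite := by
    refine (Set.finite_Iic (![m, fun _ => n] : Fin 2 → Fin K → ℕ)).subset ?_
    rintro x ⟨h0, h1⟩ i k
    fin_cases i
    · exact h0 k
    · exact (Finset.single_le_sum (f := x 1) (fun _ _ => Nat.zero_le _)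
        (Finset.mem_univ k)).trans h1
  exact h.to_subtype

noncomputable instance (m : Fin K → ℕ) (n : ℕ) : Fintype (State m n) := Fintype.ofFinite _

/-- The unit vector in the coordinate direction `(i, k)`. -/
def unit (i : Fin 2) (k : Fin K) : Fin 2 → Fin K → ℕ := Pi.single i (Pi.single k 1)

/-- The set of states in which an arriving class-`k` customer is assigned to layer `i + 1`: to
layer 1 if a dedicated server is vacant, and otherwise to layer 2 if a server is vacant there. -/
def accept (m : Fin K → ℕ) (n : ℕ) (i : Fin 2) (k : Fin K) : Set (State m n) :=
  if i = 0 then {x | x.1 0 k < m k} else {x | x.1 0 k = m k ∧ ∑ l, x.1 1 l < n}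

open Classical in
/-- The jump rates of the two-layer loss system with arrival rates `lam` and service rates `mu`:
`x ↦ x + e_{i,k}` at rate `lam k` if `x` is in `accept m n i k`, and `x ↦ x - e_{i,k}` at rate
`mu k * x_{i,k}`. -/
noncomputable def rate (m : Fin K → ℕ) (n : ℕ) (lam mu : Fin K → ℝ) (x y : State m n) : ℝ :=
  ∑ i : Fin 2, ∑ k : Fin K,
    ((if y.1 = x.1 + unit i k ∧ x ∈ accept m n i k then lam k else 0) +
      (if x.1 = y.1 + unit i k then mu k * (x.1 i k : ℝ) else 0))

/-- `X` is the process counting the customers of each class in each layer of the two-layer loss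
system with server configuration `(m, n)`, arrival rates `lam` and service rates `mu`. -/
def IsLossProcess {Ω : Type*} [MeasurableSpace Ω] (P : Measure Ω) (m : Fin K → ℕ) (n : ℕ)
    (lam mu : Fin K → ℝ) (X : Ω → Path (State m n)) : Prop :=
  IsMarkovProcess P (generator (rate m n lam mu)) X

/-- The total number of customers `|x|`. -/
def total {m : Fin K → ℕ} {n : ℕ} (x : State m n) : ℕ := ∑ i, ∑ k, x.1 i k

/-- The path `t ↦ |f(t)|` of the total number of customers. -/
def totalPath {m : Fin K → ℕ} {n : ℕ} (f : Path (State m n)) : Path ℕ :=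
  ⟨fun t => total (f.1 t), f.2.comp continuous_of_discreteTopology⟩

/-- The vector `(x_{1,1}, …, x_{1,K}; x_2)`, where `x_2` is the number of customers in layer 2. -/
def aggregate {m : Fin K → ℕ} {n : ℕ} (x : State m n) : (Fin K → ℤ) × ℤ :=
  (fun k => (x.1 0 k : ℤ), ∑ k, (x.1 1 k : ℤ))

/-- The set `Δ = {0, e₂, e₂ - e_{1,c}, 2 e₂ - e_{1,c}}`. -/
def Delta (c : Fin K) : Set ((Fin K → ℤ) × ℤ) :=
  {0, (0, 1), (0, 1) - (Pi.single c 1, 0), 2 • (0, 1) - (Pi.single c 1, 0)}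

end LossSystem

/-!
The two systems are driven by the same finite set of events, occurring at the same rates: arrivals,
labelled by the class, and service completions labelled by positions in lists of customers. For a
class `k ≠ c` the list consists of the class-`k` customers in layer 1; the remaining list consists of
the class-`c` customers in layer 1 followed by all customers in layer 2. Since the service rates are
equal, each position may be given the same rate, and the resulting generator is that of the loss
system (`generator_rate_eq_jumpMatrix`). In the states with `aggregate y - aggregate x ∈ Δ` that the
two systems occupy, the class-`c` customer which `x` may have in excess in layer 1 stands at the same
position as a customer whom `y` has in excess in layer 2. Hence every event, applied to both states,
keeps the difference in `Δ` (`arrive_mem_Delta`, `depart_mem_Delta`), and on `Δ` the totals are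
ordered (`total_le_of_mem_Delta`). So the pairs with difference in `Δ` carry a chain whose two
projections have the given generators (`sum_jumpMatrix_exp`).

It remains to pass from this chain of pairs to functionals of whole paths
(`integral_le_of_equivariant`). A path in `D(ℝ₊, S)` with `S` discrete is determined by its values at
the dyadic times, and these generate its σ-algebra (`comap_sample`), so only a law on families indexed
by the dyadic times is needed. The chains of pairs on the grids of step `2 ^ (-J)` have laws on a
compact space; a limit point of these has the laws of `X` and `Y` as its marginals
(`map_eq_map_sample_of_tendsto`), because on each cylinder event the approximating probabilities are
eventually constant. The samples of paths form a measurable set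
(`measurableSet_regularSamples`, `exists_path_of_mem_regularSamples`), so almost every coordinate
family under the limit law comes from a pair of paths, whose totals are ordered at all times.
-/

namespace LossSystem

/-! ### Semigroups driven by finitely many kinds of events -/

section JumpMatrix

variable {E S Z : Type*} [Fintype E] [Fintype S] [DecidableEq S] [Fintype Z] [DecidableEq Z]

/-- The generator of the Markov process that applies the map `T e` at rate `r e`, for each of the
finitely many events `e`. -/
def jumpMatrix (r : E → ℝ) (T : E → S → S) : Matrix S S ℝ :=
  Matrix.of fun x y => ∑ e, r e * ((if T e x = y then 1 else 0) - if x = y then 1 else 0)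

theorem hasSum_exp_apply (A : Matrix S S ℝ) (x y : S) :
    HasSum (fun n : ℕ => (n.factorial⁻¹ : ℝ) * (A ^ n) x y) (NormedSpace.exp A x y) := by
  let _ : NormedRing (Matrix S S ℝ) := Matrix.linftyOpNormedRing
  let _ : NormedAlgebra ℝ (Matrix S S ℝ) := Matrix.linftyOpNormedAlgebra
  have h := NormedSpace.exp_series_hasSum_exp' (𝕂 := ℝ) A
  exact Pi.hasSum.1 (Pi.hasSum.1 h x) y

theorem exp_apply_nonneg_of_nonneg {A : Matrix S S ℝ} (hA : ∀ x y, 0 ≤ A x y) (x y : S) :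
    0 ≤ NormedSpace.exp A x y := by
  have hpow : ∀ (n : ℕ) x y, 0 ≤ (A ^ n) x y := by
    intro n
    induction n with
    | zero =>
      intro x y
      rw [pow_zero, Matrix.one_apply]
      split_ifs <;> norm_num
    | succ n ih =>
      intro x y
      rw [pow_succ, Matrix.mul_apply]
      exact Finset.sum_nonneg fun z _ => mul_nonneg (ih x z) (hA z y)
  exact (hasSum_exp_apply A x y).nonneg fun n => mul_nonneg (by positivity) (hpow n x y)

theorem jumpMatrix_exp_nonneg {r : E → ℝ} (hr : ∀ e, 0 ≤ r e) (T : E → S → S) {t : ℝ}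
    (ht : 0 ≤ t) (x y : S) : 0 ≤ NormedSpace.exp (t • jumpMatrix r T) x y := by
  -- adding the multiple `∑ r • 1` of the identity makes all entries nonnegative
  set B : Matrix S S ℝ := Matrix.of fun x y => ∑ e, r e * if T e x = y then 1 else 0 with hB
  have hsplit : t • jumpMatrix r T = t • B + -((t * ∑ e, r e) • (1 : Matrix S S ℝ)) := by
    ext x y
    simp only [jumpMatrix, hB, Matrix.smul_apply, Matrix.of_apply, Matrix.add_apply,
      Matrix.neg_apply, Matrix.one_apply, smul_eq_mul, mul_sub, Finset.sum_sub_distrib,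
      ← Finset.sum_mul]
    ring
  have hcomm : Commute (t • B) (-((t * ∑ e, r e) • (1 : Matrix S S ℝ))) :=
    ((Commute.one_right (t • B)).smul_right _).neg_right
  have hdiag : -((t * ∑ e, r e) • (1 : Matrix S S ℝ)) =
      Matrix.diagonal fun _ => -(t * ∑ e, r e) := by
    rw [← Matrix.diagonal_one, ← Matrix.diagonal_smul, Matrix.diagonal_neg]
    congr 1
    ext
    simp
  rw [hsplit, Matrix.exp_add_of_commute _ _ hcomm, hdiag, Matrix.exp_diagonal,
    Matrix.mul_diagonal]
  refine mul_nonneg (exp_apply_nonneg_of_nonneg (fun x y => ?_) x y) ?_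
  · simp only [hB, Matrix.smul_apply, Matrix.of_apply, smul_eq_mul]
    refine mul_nonneg ht (Finset.sum_nonneg fun e _ => mul_nonneg (hr e) ?_)
    split_ifs <;> norm_num
  · rw [Pi.coe_exp, ← Real.exp_eq_exp_ℝ]
    exact (Real.exp_pos _).le

theorem sum_ite_ite_eq (p : S → Prop) [DecidablePred p] (u : S) (c : ℝ) :
    ∑ v, (if p v then (if u = v then c else 0) else 0) = if p u then c else 0 := by
  rw [Finset.sum_eq_single u (fun v _ hv => by simp [hv.symm]) (by simp)]
  simp

/-- Lumping: if `a` intertwines the maps attached to the events, then the image under `a` of the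
chain on `Z` has the transition probabilities of the chain on `S`. -/
theorem sum_jumpMatrix_exp (r : E → ℝ) (T : E → S → S) (U : E → Z → Z) (a : Z → S)
    (ha : ∀ e z, a (U e z) = T e (a z)) (t : ℝ) (z : Z) (s : S) :
    ∑ w, (if a w = s then NormedSpace.exp (t • jumpMatrix r U) z w else 0) =
      NormedSpace.exp (t • jumpMatrix r T) (a z) s := by
  set A : Matrix Z S ℝ := Matrix.of fun w s => if a w = s then 1 else 0 with hA
  have hint : (t • jumpMatrix r U) * A = A * (t • jumpMatrix r T) := by
    rw [Matrix.smul_mul, Matrix.mul_smul]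
    congr 1
    ext z s
    simp only [Matrix.mul_apply, hA, jumpMatrix, Matrix.of_apply, Finset.sum_mul, Finset.mul_sum]
    rw [Finset.sum_comm, Finset.sum_comm (s := (Finset.univ : Finset S))]
    refine Finset.sum_congr rfl fun e _ => ?_
    simp_rw [mul_assoc, sub_mul, mul_sub, Finset.sum_sub_distrib]
    simp [sum_ite_ite_eq, ha]
  have hpow : ∀ n : ℕ, (t • jumpMatrix r U) ^ n * A = A * (t • jumpMatrix r T) ^ n := by
    intro n
    induction n with
    | zero => simp
    | succ n ih => rw [pow_succ, pow_succ', Matrix.mul_assoc, hint, ← Matrix.mul_assoc, ih,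
        Matrix.mul_assoc, ← pow_succ, ← pow_succ']
  have h1 : HasSum (fun n : ℕ => (n.factorial⁻¹ : ℝ) * ((t • jumpMatrix r T) ^ n) (a z) s)
      (∑ w, (if a w = s then NormedSpace.exp (t • jumpMatrix r U) z w else 0)) := by
    have h2 : HasSum (fun n : ℕ => ∑ w, (if a w = s then
        (n.factorial⁻¹ : ℝ) * ((t • jumpMatrix r U) ^ n) z w else 0))
        (∑ w, (if a w = s then NormedSpace.exp (t • jumpMatrix r U) z w else 0)) := by
      refine hasSum_sum fun w _ => ?_
      split_ifs
      · exact hasSum_exp_apply _ z w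
      · exact hasSum_zero
    convert h2 using 2 with n
    have h3 := congrFun (congrFun (hpow n) z) s
    simp only [Matrix.mul_apply, hA, Matrix.of_apply, ite_mul, one_mul, zero_mul, mul_ite, mul_one,
      mul_zero, Finset.sum_ite_eq, Finset.mem_univ, if_true] at h3
    rw [← h3, Finset.mul_sum]
    simp
  exact h1.unique (hasSum_exp_apply _ _ _)

theorem sum_jumpMatrix_exp_eq_one (r : E → ℝ) (U : E → Z → Z) (t : ℝ) (z : Z) :
    ∑ w, NormedSpace.exp (t • jumpMatrix r U) z w = 1 := by
  have h := sum_jumpMatrix_exp r (fun _ => id) U (fun _ => ()) (fun _ _ => rfl) t z ()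
  have h0 : jumpMatrix r (fun _ : E => (id : Unit → Unit)) = 0 := by
    ext x y
    simp [jumpMatrix]
  rw [h0, smul_zero, NormedSpace.exp_zero, Matrix.one_apply_eq] at h
  simpa using h

/-- The transition probabilities `exp (t G) (z, ·)` of the chain with generator `jumpMatrix r U`. -/
noncomputable def jumpStep {r : E → ℝ} (hr : ∀ e, 0 ≤ r e) (U : E → Z → Z) {t : ℝ} (ht : 0 ≤ t)
    (z : Z) : PMF Z :=
  PMF.ofFintype (fun w => ENNReal.ofReal (NormedSpace.exp (t • jumpMatrix r U) z w)) <| by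
    rw [← ENNReal.ofReal_sum_of_nonneg fun w _ => jumpMatrix_exp_nonneg hr U ht z w,
      sum_jumpMatrix_exp_eq_one, ENNReal.ofReal_one]

theorem jumpStep_fiber {r : E → ℝ} (hr : ∀ e, 0 ≤ r e) (T : E → S → S) (U : E → Z → Z)
    (a : Z → S) (ha : ∀ e z, a (U e z) = T e (a z)) {t : ℝ} (ht : 0 ≤ t) (z : Z) (s : S) :
    (jumpStep hr U ht z).toOuterMeasure {w | a w = s} =
      ENNReal.ofReal (NormedSpace.exp (t • jumpMatrix r T) (a z) s) := by
  rw [PMF.toOuterMeasure_apply_fintype, ← sum_jumpMatrix_exp r T U a ha,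
    ENNReal.ofReal_sum_of_nonneg]
  · refine Finset.sum_congr rfl fun w _ => ?_
    simp only [Set.indicator_apply, Set.mem_ofPred_eq, jumpStep, PMF.ofFintype_apply]
    split_ifs <;> simp
  · intro w _
    split_ifs
    · exact jumpMatrix_exp_nonneg hr U ht z w
    · exact le_rfl

end JumpMatrix

/-! ### Discrete-time chains -/

section Chain

variable {Z S : Type*}

/-- The law of a path `z 0, z 1, …` of the discrete-time Markov chain with initial law `ν` and
transition kernel `κ`, frozen after time `L`. -/
noncomputable def chainLaw (ν : PMF Z) (κ : Z → PMF Z) : ℕ → PMF (ℕ → Z)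
  | 0 => ν.map fun z _ => z
  | L + 1 => (chainLaw ν κ L).bind fun z => (κ (z L)).map fun y i => if i ≤ L then z i else y

theorem chainLaw_cylinder (ν : PMF Z) (κ : Z → PMF Z) (a : Z → S) (q : S → S → ENNReal)
    (hq : ∀ z s, (κ z).toOuterMeasure {w | a w = s} = q (a z) s) (x : ℕ → S) (L : ℕ) :
    (chainLaw ν κ L).toOuterMeasure {z | ∀ i ≤ L, a (z i) = x i} =
      ν.toOuterMeasure {z | a z = x 0} * ∏ i ∈ Finset.range L, q (x i) (x (i + 1)) := by
  induction L with
  | zero =>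
    rw [chainLaw, PMF.toOuterMeasure_map_apply]
    simp
  | succ L ih =>
    rw [Finset.prod_range_succ, ← mul_assoc, ← ih, chainLaw, PMF.toOuterMeasure_bind_apply,
      PMF.toOuterMeasure_apply, ← ENNReal.tsum_mul_right]
    refine tsum_congr fun z => ?_
    rw [PMF.toOuterMeasure_map_apply]
    have hpre : (fun (y : Z) (i : ℕ) => if i ≤ L then z i else y) ⁻¹'
        {z | ∀ i ≤ L + 1, a (z i) = x i} =
        {y | (∀ i ≤ L, a (z i) = x i) ∧ a y = x (L + 1)} := by
      ext y
      simp only [Set.mem_preimage, Set.mem_ofPred_eq]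
      constructor
      · intro h
        refine ⟨fun i hi => ?_, ?_⟩
        · simpa [hi] using h i (by omega)
        · simpa using h (L + 1) le_rfl
      · rintro ⟨h1, h2⟩ i hi
        by_cases hiL : i ≤ L
        · simpa [hiL] using h1 i hiL
        · obtain rfl : i = L + 1 := by omega
          simpa using h2
    rw [hpre]
    by_cases h : ∀ i ≤ L, a (z i) = x i
    · have hs : {y | (∀ i ≤ L, a (z i) = x i) ∧ a y = x (L + 1)} = {y | a y = x (L + 1)} := by
        ext y
        simp only [Set.mem_ofPred_eq, and_iff_right_iff_imp]
        exact fun _ => h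
      rw [hs, hq, Set.indicator_of_mem (by exact h), h L le_rfl]
    · have hs : {y | (∀ i ≤ L, a (z i) = x i) ∧ a y = x (L + 1)} = ∅ := by
        ext y
        simp only [Set.mem_ofPred_eq, Set.mem_empty_iff_false, iff_false]
        exact fun h' => h h'.1
      rw [hs, Set.indicator_of_notMem (by exact h)]
      simp

end Chain

/-! ### Paths with values in a discrete space, observed on a countable dense set of times -/

section Paths

variable {S ι : Type*} {τ : ι → ℝ≥0}

theorem IsCadlag.exists_eq_right [TopologicalSpace S] [DiscreteTopology S]
    {f : ℝ≥0 → S} (hf : IsCadlag f) (t : ℝ≥0) :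
    ∃ ε > 0, ∀ s, t ≤ s → dist s t < ε → f s = f t := by
  have h : ∀ᶠ s in 𝓝[Set.Ici t] t, f s = f t :=
    (hf t).1.eventually (IsOpen.mem_nhds (isOpen_discrete {f t}) rfl)
  obtain ⟨ε, hε, hsub⟩ := Metric.mem_nhdsWithin_iff.1 h
  exact ⟨ε, hε, fun s hs hd => hsub ⟨hd, hs⟩⟩

theorem IsCadlag.exists_eq_left [TopologicalSpace S] [DiscreteTopology S]
    {f : ℝ≥0 → S} (hf : IsCadlag f) (t : ℝ≥0) :
    ∃ ε > 0, ∃ c, ∀ s, s < t → dist s t < ε → f s = c := by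
  obtain ⟨c, hc⟩ := (hf t).2
  have h : ∀ᶠ s in 𝓝[<] t, f s = c :=
    hc.eventually (IsOpen.mem_nhds (isOpen_discrete {c}) rfl)
  obtain ⟨ε, hε, hsub⟩ := Metric.mem_nhdsWithin_iff.1 h
  exact ⟨ε, hε, c, fun s hs hd => hsub ⟨hd, hs⟩⟩

theorem isCadlag_of_exists_eq [TopologicalSpace S] {f : ℝ≥0 → S}
    (hr : ∀ t, ∃ ε > 0, ∀ s, t ≤ s → dist s t < ε → f s = f t)
    (hl : ∀ t, ∃ ε > 0, ∃ c, ∀ s, s < t → dist s t < ε → f s = c) : IsCadlag f := by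
  intro t
  constructor
  · obtain ⟨ε, hε, h⟩ := hr t
    refine tendsto_nhds_of_eventually_eq ?_
    exact Metric.mem_nhdsWithin_iff.2 ⟨ε, hε, fun s hs => h s hs.2 hs.1⟩
  · obtain ⟨ε, hε, c, h⟩ := hl t
    refine ⟨c, tendsto_nhds_of_eventually_eq ?_⟩
    exact Metric.mem_nhdsWithin_iff.2 ⟨ε, hε, fun s hs => h s hs.2 hs.1⟩

/-- The values of a path at the times `τ i`. -/
def sample [TopologicalSpace S] (τ : ι → ℝ≥0) (f : Path S) (i : ι) : S := f.1 (τ i)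

theorem measurable_sample [TopologicalSpace S] [MeasurableSpace S] (τ : ι → ℝ≥0) :
    Measurable (sample τ : Path S → ι → S) :=
  measurable_pi_lambda _ fun i => (measurable_pi_apply (τ i)).comp measurable_subtype_coe

/-- The families `x i` that are right-continuous as functions of the time `τ i` and, among any three
sufficiently close times before `k`, change their value at most once. When the times `τ i` are dense
these are exactly the samples of the paths in `D(ℝ₊, S)`, and only countably many conditions are
involved. -/
def regularSamples (S : Type*) (τ : ι → ℝ≥0) : Set (ι → S) :=
  {x | (∀ i, ∃ n : ℕ, ∀ j, τ i ≤ τ j → dist (τ j) (τ i) < 1 / ((n : ℝ) + 1) → x j = x i) ∧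
    ∀ k : ℕ, ∃ n : ℕ, ∀ u v w, τ u < τ v → τ v < τ w → τ w ≤ k →
      dist (τ u) (τ w) < 1 / ((n : ℝ) + 1) → x u = x v ∨ x v = x w}

theorem measurableSet_regularSamples [Countable ι] [Countable S] [MeasurableSpace S]
    [MeasurableSingletonClass S] : MeasurableSet (regularSamples S τ) := by
  have heq : ∀ i j, MeasurableSet {x : ι → S | x i = x j} := by
    intro i j
    have h : Measurable fun x : ι → S => (x i, x j) :=
      (measurable_pi_apply i).prodMk (measurable_pi_apply j)
    exact h (Set.to_countable {p : S × S | p.1 = p.2}).measurableSet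
  rw [regularSamples, Set.ofPred_and]
  refine MeasurableSet.inter ?_ ?_
  · simp only [Set.ofPred_forall, Set.ofPred_exists]
    exact .iInter fun i => .iUnion fun n => .iInter fun j => .iInter fun _ => .iInter fun _ =>
      heq j i
  · simp only [Set.ofPred_forall, Set.ofPred_exists, Set.ofPred_or]
    exact .iInter fun k => .iUnion fun n => .iInter fun u => .iInter fun v => .iInter fun w =>
      .iInter fun _ => .iInter fun _ => .iInter fun _ => .iInter fun _ => (heq u v).union (heq v w)

theorem sample_mem_regularSamples [TopologicalSpace S] [DiscreteTopology S] (f : Path S) : sample τ f ∈ regularSamples S τ := by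
  constructor
  · intro i
    obtain ⟨ε, hε, h⟩ := f.2.exists_eq_right (τ i)
    obtain ⟨n, hn⟩ := exists_nat_one_div_lt hε
    exact ⟨n, fun j hj hd => h _ hj (hd.trans hn)⟩
  · intro k
    choose ε hε hr using f.2.exists_eq_right
    choose ε' hε' c hl using f.2.exists_eq_left
    -- on each ball of this cover the path is constant on either side of the centre
    obtain ⟨δ, hδ, hball⟩ := lebesgue_number_lemma_of_metric
      (isCompact_Icc (a := 0) (b := (k : ℝ≥0)))
      (c := fun t => Metric.ball t (min (ε t) (ε' t))) (fun _ => Metric.isOpen_ball)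
      (fun t _ => Set.mem_iUnion.2 ⟨t, Metric.mem_ball_self (lt_min (hε t) (hε' t))⟩)
    obtain ⟨n, hn⟩ := exists_nat_one_div_lt hδ
    refine ⟨n, fun u v w huv hvw hwk hd => ?_⟩
    obtain ⟨t, ht⟩ := hball (τ w) ⟨zero_le, hwk⟩
    have hu := ht (Metric.mem_ball.2 (hd.trans hn))
    have hv : τ v ∈ Metric.ball (τ w) δ := by
      refine Metric.mem_ball.2 (lt_of_le_of_lt ?_ (hd.trans hn))
      rw [dist_comm, dist_comm (τ u), NNReal.dist_eq, NNReal.dist_eq, abs_of_nonneg, abs_of_nonneg]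
      · have : (τ u : ℝ) ≤ τ v := huv.le
        linarith
      · exact sub_nonneg.2 (huv.trans hvw).le
      · exact sub_nonneg.2 hvw.le
    have hv := ht hv
    have hw := ht (Metric.mem_ball_self hδ)
    rw [Metric.mem_ball, lt_min_iff] at hu hv hw
    rcases lt_or_ge (τ v) t with hvt | hvt
    · left
      exact (hl t _ (huv.trans hvt) hu.2).trans (hl t _ hvt hv.2).symm
    · right
      exact (hr t _ hvt hv.1).trans (hr t _ (hvt.trans hvw.le) hw.1).symm

theorem DenseRange.exists_right (hτ : DenseRange τ) (t : ℝ≥0) {ε : ℝ} (hε : 0 < ε) :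
    ∃ i, t < τ i ∧ dist (τ i) t < ε := by
  have h : t < t + ⟨ε, hε.le⟩ := lt_add_of_pos_right t hε
  obtain ⟨i, h1, h2⟩ := hτ.exists_mem_open isOpen_Ioo (Set.nonempty_Ioo.2 h)
  refine ⟨i, h1, ?_⟩
  have h1' : (t : ℝ) < τ i := h1
  have h2' : (τ i : ℝ) < t + ε := h2
  rw [NNReal.dist_eq, abs_lt]
  constructor <;> linarith

theorem regularSamples.exists_eq_right (hτ : DenseRange τ) {x : ι → S}
    (hx : x ∈ regularSamples S τ) (t : ℝ≥0) :
    ∃ ε > 0, ∃ c, ∀ j, t ≤ τ j → dist (τ j) t < ε → x j = c := by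
  by_cases ht : ∃ i, τ i = t
  · obtain ⟨i, rfl⟩ := ht
    obtain ⟨n, hn⟩ := hx.1 i
    exact ⟨_, Nat.one_div_pos_of_nat, x i, hn⟩
  have hlt : ∀ j, t ≤ τ j → t < τ j := fun j hj => lt_of_le_of_ne hj fun h => ht ⟨j, h.symm⟩
  obtain ⟨k, hk⟩ := exists_nat_ge (t + 1)
  obtain ⟨n, hn⟩ := hx.2 k
  have hpos : (0 : ℝ) < 1 / ((n : ℝ) + 1) := Nat.one_div_pos_of_nat
  have hle : ∀ j, dist (τ j) t < 1 / ((n : ℝ) + 1) → τ j ≤ k := by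
    intro j hj
    refine le_trans ?_ hk
    have h1 : (1 : ℝ) / ((n : ℝ) + 1) ≤ 1 := by
      rw [div_le_one (by positivity)]
      linarith [n.cast_nonneg (α := ℝ)]
    rw [NNReal.dist_eq] at hj
    have := (abs_lt.1 hj).2
    rw [← NNReal.coe_le_coe]
    push_cast
    linarith
  have hdist : ∀ u w, t < τ u → τ u < τ w → dist (τ w) t < 1 / ((n : ℝ) + 1) →
      dist (τ u) (τ w) < 1 / ((n : ℝ) + 1) := by
    intro u w hu huw hw
    have h1 : (t : ℝ) < τ u := hu
    have h2 : (τ u : ℝ) < τ w := huw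
    rw [NNReal.dist_eq, abs_lt] at hw ⊢
    constructor <;> linarith [hw.1, hw.2]
  by_cases hch : ∃ v w, t < τ v ∧ τ v < τ w ∧ dist (τ w) t < 1 / ((n : ℝ) + 1) ∧ x v ≠ x w
  · obtain ⟨v, w, hv, hvw, hw, hne⟩ := hch
    refine ⟨dist (τ v) t, dist_pos.2 hv.ne', x v, fun u hu hd => ?_⟩
    have huv : τ u < τ v := by
      have h1 : (t : ℝ) < τ v := hv
      have h2 : (t : ℝ) ≤ τ u := hu
      rw [NNReal.dist_eq, NNReal.dist_eq, abs_of_nonneg (by linarith),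
        abs_of_nonneg (by linarith)] at hd
      rw [← NNReal.coe_lt_coe]
      linarith
    exact (hn u v w huv hvw (hle w hw)
      (hdist u w (hlt u hu) (huv.trans hvw) hw)).resolve_right hne
  · push Not at hch
    obtain ⟨i, hi, hid⟩ := DenseRange.exists_right hτ t hpos
    refine ⟨_, hpos, x i, fun j hj hd => ?_⟩
    rcases lt_trichotomy (τ i) (τ j) with h | h | h
    · exact (hch i j hi h hd).symm
    · obtain ⟨n', hn'⟩ := hx.1 i
      exact hn' j h.le (by rw [h, dist_self]; exact Nat.one_div_pos_of_nat)
    · exact hch j i (hlt j hj) h hid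

theorem regularSamples.exists_eq_left (hτ : DenseRange τ) {x : ι → S}
    (hx : x ∈ regularSamples S τ) (t : ℝ≥0) :
    ∃ ε > 0, ∃ c, ∀ j, τ j < t → dist (τ j) t < ε → x j = c := by
  obtain ⟨k, hk⟩ := exists_nat_ge t
  obtain ⟨n, hn⟩ := hx.2 k
  have hpos : (0 : ℝ) < 1 / ((n : ℝ) + 1) := Nat.one_div_pos_of_nat
  have hdist : ∀ u w, τ u < τ w → τ w < t → dist (τ u) t < 1 / ((n : ℝ) + 1) →
      dist (τ u) (τ w) < 1 / ((n : ℝ) + 1) := by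
    intro u w huw hw hu
    have h1 : (τ w : ℝ) < t := hw
    have h2 : (τ u : ℝ) < τ w := huw
    rw [NNReal.dist_eq, abs_lt] at hu ⊢
    constructor <;> linarith [hu.1, hu.2]
  by_cases hch : ∃ u v, τ u < τ v ∧ τ v < t ∧ dist (τ u) t < 1 / ((n : ℝ) + 1) ∧ x u ≠ x v
  · obtain ⟨u, v, huv, hv, hu, hne⟩ := hch
    refine ⟨dist (τ v) t, dist_pos.2 hv.ne, x v, fun w hw hd => ?_⟩
    have hvw : τ v < τ w := by
      have h1 : (τ v : ℝ) < t := hv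
      have h2 : (τ w : ℝ) < t := hw
      rw [NNReal.dist_eq, NNReal.dist_eq, abs_of_nonpos (by linarith),
        abs_of_nonpos (by linarith)] at hd
      rw [← NNReal.coe_lt_coe]
      linarith
    exact ((hn u v w huv hvw (hw.le.trans hk)
      (hdist u w (huv.trans hvw) hw hu)).resolve_left hne).symm
  · push Not at hch
    by_cases hi : ∃ i, τ i < t ∧ dist (τ i) t < 1 / ((n : ℝ) + 1)
    · obtain ⟨i, hi, hid⟩ := hi
      refine ⟨_, hpos, x i, fun j hj hd => ?_⟩
      rcases lt_trichotomy (τ i) (τ j) with h | h | h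
      · exact (hch i j h hj hid).symm
      · obtain ⟨n', hn'⟩ := hx.1 i
        exact hn' j h.le (by rw [h, dist_self]; exact Nat.one_div_pos_of_nat)
      · exact hch j i h hi hd
    · obtain ⟨i, -⟩ := DenseRange.exists_right hτ t hpos
      exact ⟨_, hpos, x i, fun j hj hd => absurd ⟨j, hj, hd⟩ hi⟩

theorem exists_path_of_mem_regularSamples [TopologicalSpace S] (hτ : DenseRange τ) {x : ι → S}
    (hx : x ∈ regularSamples S τ) : ∃ f : Path S, sample τ f = x := by
  choose ε hε c hc using regularSamples.exists_eq_right hτ hx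
  refine ⟨⟨c, isCadlag_of_exists_eq (fun t => ⟨ε t, hε t, fun s hs hd => ?_⟩) fun t => ?_⟩, ?_⟩
  · -- `c s` and `c t` are both the value of `x` at a time shortly after `s`
    obtain ⟨i, hi, hid⟩ := DenseRange.exists_right hτ s (lt_min (hε s) (sub_pos.2 hd))
    rw [lt_min_iff] at hid
    rw [← hc s i hi.le hid.1]
    refine hc t i (hs.trans hi.le) ?_
    linarith [dist_triangle (τ i) s t]
  · obtain ⟨δ, hδ, l, hl⟩ := regularSamples.exists_eq_left hτ hx t
    refine ⟨δ, hδ, l, fun s hs hd => ?_⟩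
    obtain ⟨i, hi, hid⟩ := DenseRange.exists_right hτ s (lt_min (hε s) (dist_pos.2 hs.ne))
    rw [lt_min_iff] at hid
    rw [← hc s i hi.le hid.1]
    have h1 : (s : ℝ) < t := hs
    have h2 : (s : ℝ) < τ i := hi
    have hid2 := hid.2
    rw [NNReal.dist_eq, NNReal.dist_eq, abs_of_nonneg (by linarith),
      abs_of_nonpos (by linarith)] at hid2
    have h3 : τ i < t := by
      rw [← NNReal.coe_lt_coe]
      linarith
    have h4 : (τ i : ℝ) < t := h3
    refine hl i h3 (lt_of_le_of_lt ?_ hd)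
    rw [NNReal.dist_eq, NNReal.dist_eq, abs_of_nonpos (by linarith), abs_of_nonpos (by linarith)]
    linarith
  · ext i
    exact (hc (τ i) i le_rfl (by rw [dist_self]; exact hε _)).symm

theorem comap_sample [TopologicalSpace S] [DiscreteTopology S] [Countable S]
    [MeasurableSpace S] [MeasurableSingletonClass S]    (hτ : DenseRange τ) :
    MeasurableSpace.comap (sample τ : Path S → ι → S) MeasurableSpace.pi =
      Subtype.instMeasurableSpace := by
  refine le_antisymm (measurable_sample τ).comap_le ?_
  have hpos : ∀ n : ℕ, (0 : ℝ) < 1 / ((n : ℝ) + 1) := fun n => Nat.one_div_pos_of_nat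
  refine measurable_iff_comap_le.1 ((@measurable_pi_iff _ _ _ (_) _ _).2 fun t => ?_)
  choose i hi hid using fun n : ℕ => DenseRange.exists_right hτ t (hpos n)
  refine @measurable_to_countable' _ _ _ _ (_) _ fun s => ?_
  -- by right-continuity the value at `t` is that at the times `τ (i n)` for large `n`
  refine ⟨{x : ι → S | ∃ N, ∀ n ≥ N, x (i n) = s}, ?_, ?_⟩
  · simp only [Set.ofPred_forall, Set.ofPred_exists]
    refine .iUnion fun N => .iInter fun n => .iInter fun _ => ?_
    have h : Measurable fun x : ι → S => x (i n) := measurable_pi_apply (i n)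
    exact h (measurableSet_singleton s)
  · ext f
    obtain ⟨ε, hε, h⟩ := f.2.exists_eq_right t
    obtain ⟨N, hN⟩ := exists_nat_one_div_lt hε
    have hlim : ∀ n ≥ N, f.1 (τ (i n)) = f.1 t := by
      intro n hn
      refine h _ (hi n).le ((hid n).trans (lt_of_le_of_lt ?_ hN))
      exact one_div_le_one_div_of_le (by positivity) (by exact_mod_cast Nat.succ_le_succ hn)
    simp only [Set.mem_preimage, Set.mem_ofPred_eq, sample, Set.mem_singleton_iff]
    constructor
    · rintro ⟨M, hM⟩
      rw [← hlim (max M N) (le_max_right _ _)]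
      exact hM _ (le_max_left _ _)
    · intro hs
      exact ⟨N, fun n hn => (hlim n hn).trans hs⟩

end Paths

/-! ### Coupling of Markov processes driven by common events -/

section Coupling

/-- The dyadic times `i / 2 ^ j`, indexed by the pairs `(i, j)`. -/
noncomputable def dyadic (p : ℕ × ℕ) : ℝ≥0 := p.1 / 2 ^ p.2

theorem denseRange_dyadic : DenseRange dyadic := by
  refine dense_of_exists_between fun a b hab => ?_
  have hab' : (a : ℝ) < b := hab
  obtain ⟨j, hj⟩ := exists_pow_lt_of_lt_one (sub_pos.2 hab') (by norm_num : (1 / 2 : ℝ) < 1)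
  have h2 : (0 : ℝ) < 2 ^ j := by positivity
  have hj' : 1 < (b - a : ℝ) * 2 ^ j := by
    rwa [one_div, inv_pow, inv_lt_iff_one_lt_mul₀ h2] at hj
  refine ⟨dyadic (⌊(a : ℝ) * 2 ^ j⌋₊ + 1, j), ⟨_, rfl⟩, ?_, ?_⟩
  · rw [← NNReal.coe_lt_coe]
    simp only [dyadic, NNReal.coe_div, NNReal.coe_natCast, NNReal.coe_pow, NNReal.coe_ofNat]
    rw [lt_div_iff₀ h2]
    push_cast
    exact Nat.lt_floor_add_one _
  · rw [← NNReal.coe_lt_coe]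
    simp only [dyadic, NNReal.coe_div, NNReal.coe_natCast, NNReal.coe_pow, NNReal.coe_ofNat]
    rw [div_lt_iff₀ h2]
    push_cast
    have := Nat.floor_le (by positivity : 0 ≤ (a : ℝ) * 2 ^ j)
    linarith

variable {Ω E Z S : Type*} [MeasurableSpace Ω] {P : Measure Ω} [IsProbabilityMeasure P] [Fintype E]
  [Fintype Z] [DecidableEq Z] [MeasurableSpace Z] [DiscreteMeasurableSpace Z]
  [Fintype S] [DecidableEq S] [TopologicalSpace S] [MeasurableSpace S] [DiscreteMeasurableSpace S]
  {r : E → ℝ}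

theorem map_chainLaw_eq_map_sample (hr : ∀ e, 0 ≤ r e) (T : E → S → S) (U : E → Z → Z) (a : Z → S)
    (ha : ∀ e z, a (U e z) = T e (a z)) {X : Ω → Path S}
    (hX : IsMarkovProcess P (jumpMatrix r T) X) (ν : PMF Z)
    (hν : ∀ s, ν.toOuterMeasure {z | a z = s} = P {ω | (X ω).1 0 = s}) (h : ℝ≥0) (L : ℕ) :
    (chainLaw ν (jumpStep hr U h.coe_nonneg) L).toMeasure.map
        (fun z (i : Fin (L + 1)) => a (z i)) =
      P.map fun ω (i : Fin (L + 1)) => (X ω).1 (i * h) := by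
  have hm1 : Measurable fun (z : ℕ → Z) (i : Fin (L + 1)) => a (z i) :=
    measurable_pi_lambda _ fun i => Measurable.of_discrete.comp (measurable_pi_apply _)
  have hm2 : Measurable fun ω (i : Fin (L + 1)) => (X ω).1 (i * h) :=
    measurable_pi_lambda _ fun i =>
      ((measurable_pi_apply _).comp measurable_subtype_coe).comp hX.measurable
  refine Measure.ext_of_singleton fun v => ?_
  rw [Measure.map_apply hm1 (measurableSet_singleton v),
    Measure.map_apply hm2 (measurableSet_singleton v)]
  set x : ℕ → S := fun i => v ⟨min i L, by omega⟩ with hx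
  have hxv : ∀ i : Fin (L + 1), x i = v i := fun i => by
    simp only [hx]
    congr 1
    ext
    simp only
    omega
  have hmin : ∀ (i : ℕ) (hi : i ≤ L), v ⟨i, by omega⟩ = x i := fun i hi =>
    (hxv ⟨i, by omega⟩).symm
  have h1 : (fun (z : ℕ → Z) (i : Fin (L + 1)) => a (z i)) ⁻¹' {v} =
      {z | ∀ i ≤ L, a (z i) = x i} := by
    ext z
    simp only [Set.mem_preimage, Set.mem_singleton_iff, Set.mem_ofPred_eq, funext_iff]
    exact ⟨fun H i hi => (H ⟨i, by omega⟩).trans (hmin i hi),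
      fun H i => (H i (by omega)).trans (hxv i)⟩
  have h2 : (fun ω (i : Fin (L + 1)) => (X ω).1 (i * h)) ⁻¹' {v} =
      {ω | ∀ i ≤ L, (X ω).1 ((i : ℝ≥0) * h) = x i} := by
    ext z
    simp only [Set.mem_preimage, Set.mem_singleton_iff, Set.mem_ofPred_eq, funext_iff]
    exact ⟨fun H i hi => (H ⟨i, by omega⟩).trans (hmin i hi),
      fun H i => (H i (by omega)).trans (hxv i)⟩
  rw [h1, h2, PMF.toMeasure_apply_eq_toOuterMeasure_apply, chainLaw_cylinder ν _ a
    (fun s s' => ENNReal.ofReal (NormedSpace.exp ((h : ℝ) • jumpMatrix r T) s s'))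
    (fun z s => jumpStep_fiber hr T U a ha _ z s), hν,
    ← ENNReal.ofReal_toReal (measure_ne_top P {ω | ∀ i ≤ L, (X ω).1 ((i : ℝ≥0) * h) = x i})]
  · have hmk := hX.markov L (fun i => (i : ℝ≥0) * h) x fun i j hij => by
      dsimp only
      gcongr
    rw [measureReal_def] at hmk
    rw [hmk, ENNReal.ofReal_mul measureReal_nonneg, ENNReal.ofReal_prod_of_nonneg]
    · congr 1
      · rw [measureReal_def, ENNReal.ofReal_toReal (measure_ne_top _ _)]
        simp
      · refine Finset.prod_congr rfl fun i _ => ?_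
        have hstep : (((i + 1 : ℕ) : ℝ≥0) * h : ℝ≥0) - ((i : ℝ≥0) * h : ℝ≥0) = (h : ℝ) := by
          push_cast
          ring
        rw [hstep]
    · intro i _
      refine jumpMatrix_exp_nonneg hr T ?_ _ _
      push_cast
      linarith [h.coe_nonneg]
  · rw [← h1]
    exact hm1 (measurableSet_singleton v)

/-- The law, at the dyadic times, of the chain with generator `jumpMatrix r U` observed on the grid
of step `2 ^ (-J)` up to time `J`. At the dyadic times that are not on this grid, or later than `J`,
its values carry no meaning. -/
noncomputable def gridLaw (hr : ∀ e, 0 ≤ r e) (U : E → Z → Z) (ν : PMF Z) (J : ℕ) :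
    ProbabilityMeasure (ℕ × ℕ → Z) :=
  ⟨(chainLaw ν (jumpStep hr U (1 / 2 ^ J : ℝ≥0).coe_nonneg) (J * 2 ^ J)).toMeasure.map
      fun z p => z (p.1 * 2 ^ (J - p.2)),
    Measure.isProbabilityMeasure_map
      (measurable_pi_lambda _ fun _ => measurable_pi_apply _).aemeasurable⟩

theorem gridLaw_cylinder (hr : ∀ e, 0 ≤ r e) (T : E → S → S) (U : E → Z → Z) (a : Z → S)
    (ha : ∀ e z, a (U e z) = T e (a z)) {X : Ω → Path S}
    (hX : IsMarkovProcess P (jumpMatrix r T) X) (ν : PMF Z)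
    (hν : ∀ s, ν.toOuterMeasure {z | a z = s} = P {ω | (X ω).1 0 = s}) (I : Finset (ℕ × ℕ))
    (v : I → S) (J : ℕ) (hJ : ∀ p ∈ I, p.1 ≤ J ∧ p.2 ≤ J) :
    (gridLaw hr U ν J : Measure (ℕ × ℕ → Z)) {z | ∀ p : I, a (z p) = v p} =
      P {ω | ∀ p : I, (X ω).1 (dyadic p) = v p} := by
  have hidx : ∀ p : I, p.1.1 * 2 ^ (J - p.1.2) ≤ J * 2 ^ J := fun p =>
    Nat.mul_le_mul (hJ p p.2).1 (Nat.pow_le_pow_right (by norm_num) (Nat.sub_le _ _))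
  have hdy : ∀ p : I, dyadic p = ((p.1.1 * 2 ^ (J - p.1.2) : ℕ) : ℝ≥0) * (1 / 2 ^ J) := by
    intro p
    have hpow : (2 : ℝ≥0) ^ J = 2 ^ (J - p.1.2) * 2 ^ p.1.2 := by
      rw [← pow_add, Nat.sub_add_cancel (hJ p p.2).2]
    rw [dyadic, hpow]
    push_cast
    field_simp
  set A : Set (Fin (J * 2 ^ J + 1) → S) :=
    {y | ∀ p : I, y ⟨p.1.1 * 2 ^ (J - p.1.2), Nat.lt_succ_of_le (hidx p)⟩ = v p} with hA
  have hAm : MeasurableSet A := A.to_countable.measurableSet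
  have key := congrArg (fun μ => μ A) (map_chainLaw_eq_map_sample hr T U a ha hX ν hν (1 / 2 ^ J)
    (J * 2 ^ J))
  have hm1 : Measurable fun (z : ℕ → Z) (i : Fin (J * 2 ^ J + 1)) => a (z i) :=
    measurable_pi_lambda _ fun i => Measurable.of_discrete.comp (measurable_pi_apply _)
  have hm2 : Measurable fun ω (i : Fin (J * 2 ^ J + 1)) => (X ω).1 (i * (1 / 2 ^ J)) :=
    measurable_pi_lambda _ fun i =>
      ((measurable_pi_apply _).comp measurable_subtype_coe).comp hX.measurable
  rw [Measure.map_apply hm1 hAm, Measure.map_apply hm2 hAm] at key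
  have hms : MeasurableSet {z : ℕ × ℕ → Z | ∀ p : I, a (z p) = v p} := by
    rw [Set.ofPred_forall]
    refine MeasurableSet.iInter fun p => ?_
    have h : Measurable fun z : ℕ × ℕ → Z => a (z p) :=
      Measurable.of_discrete.comp (measurable_pi_apply _)
    exact h (measurableSet_singleton (v p))
  rw [gridLaw, ProbabilityMeasure.coe_mk, Measure.map_apply
    (measurable_pi_lambda _ fun _ => measurable_pi_apply _) hms]
  refine Eq.trans ?_ (key.trans ?_)
  · rfl
  · congr 1
    ext ω
    simp only [hA, Set.mem_preimage, Set.mem_ofPred_eq, hdy]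

variable [TopologicalSpace Z] [DiscreteTopology Z] [DiscreteTopology S]

theorem map_eq_map_sample_of_tendsto (hr : ∀ e, 0 ≤ r e) (T : E → S → S) (U : E → Z → Z) (a : Z → S)
    (ha : ∀ e z, a (U e z) = T e (a z)) {X : Ω → Path S}
    (hX : IsMarkovProcess P (jumpMatrix r T) X) (ν : PMF Z)
    (hν : ∀ s, ν.toOuterMeasure {z | a z = s} = P {ω | (X ω).1 0 = s})
    {l : Filter ℕ} [l.NeBot] (hl : l ≤ atTop) {μ : ProbabilityMeasure (ℕ × ℕ → Z)}
    (hμ : Tendsto (gridLaw hr U ν) l (𝓝 μ)) :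
    (μ : Measure (ℕ × ℕ → Z)).map (fun z p => a (z p)) = P.map fun ω => sample dyadic (X ω) := by
  have hm1 : Measurable fun (z : ℕ × ℕ → Z) p => a (z p) :=
    measurable_pi_lambda _ fun i => Measurable.of_discrete.comp (measurable_pi_apply _)
  have hm2 : Measurable fun ω => sample dyadic (X ω) := (measurable_sample _).comp hX.measurable
  have : IsProbabilityMeasure (P.map fun ω => sample dyadic (X ω)) :=
    Measure.isProbabilityMeasure_map hm2.aemeasurable
  refine IsProjectiveLimit.unique (P := fun I : Finset (ℕ × ℕ) =>
    (P.map fun ω => sample dyadic (X ω)).map I.restrict) (fun I => ?_) fun I => rfl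
  refine Measure.ext_of_singleton fun v => ?_
  dsimp only
  have hres : Measurable (I.restrict : (ℕ × ℕ → S) → I → S) := Finset.measurable_restrict I
  rw [Measure.map_map hres hm1, Measure.map_map hres hm2,
    Measure.map_apply (hres.comp hm1) (measurableSet_singleton v),
    Measure.map_apply (hres.comp hm2) (measurableSet_singleton v)]
  have h1 : (I.restrict ∘ fun (z : ℕ × ℕ → Z) p => a (z p)) ⁻¹' {v} =
      {z | ∀ p : I, a (z p) = v p} := by
    ext z
    simp only [Set.mem_preimage, Set.mem_singleton_iff, Set.mem_ofPred_eq, funext_iff]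
    rfl
  have h2 : (I.restrict ∘ fun ω => sample dyadic (X ω)) ⁻¹' {v} =
      {ω | ∀ p : I, (X ω).1 (dyadic p) = v p} := by
    ext z
    simp only [Set.mem_preimage, Set.mem_singleton_iff, Set.mem_ofPred_eq, funext_iff]
    rfl
  rw [h1, h2]
  have hclopen : IsClopen {z : ℕ × ℕ → Z | ∀ p : I, a (z p) = v p} := by
    rw [← h1]
    refine (isClopen_discrete {v}).preimage ?_
    exact continuous_pi fun p => continuous_of_discreteTopology.comp (continuous_apply (p : ℕ × ℕ))
  have hlim := ProbabilityMeasure.tendsto_measure_of_isClopen_of_tendsto hμ hclopen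
  have hev : ∀ᶠ J in l, (gridLaw hr U ν J) {z | ∀ p : I, a (z p) = v p} =
      (P {ω | ∀ p : I, (X ω).1 (dyadic p) = v p}).toNNReal := by
    have hb : ∀ᶠ J in atTop, ∀ p ∈ I, p.1 ≤ J ∧ p.2 ≤ J :=
      (I.eventually_all).2 fun p _ => (eventually_ge_atTop p.1).and (eventually_ge_atTop p.2)
    filter_upwards [hl hb] with J hJ
    rw [← gridLaw_cylinder hr T U a ha hX ν hν I v J hJ]
    rfl
  have heq := tendsto_nhds_unique hlim (tendsto_const_nhds.congr' (hev.mono fun _ h => h.symm))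
  rw [← ENNReal.coe_toNNReal (measure_ne_top P _), ← heq]
  exact (ProbabilityMeasure.ennreal_coeFn_eq_coeFn_toMeasure _ _).symm

variable {S' : Type*} [Fintype S'] [DecidableEq S'] [TopologicalSpace S'] [DiscreteTopology S']
  [MeasurableSpace S'] [DiscreteMeasurableSpace S']

/-- Let `X` and `Y` be driven by the same events, at the same rates, and let `a : Z → S` and
`b : Z → S'` be equivariant maps such that `(X 0, Y 0)` almost surely has the form `(a z, b z)`.
Then `X` and `Y` have copies whose joint paths stay in the set of all `(a z, b z)`; hence functionals
of the paths that are ordered on such pairs have ordered expectations. -/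
theorem integral_le_of_equivariant (hr : ∀ e, 0 ≤ r e) (T : E → S → S) (T' : E → S' → S')
    (U : E → Z → Z) (a : Z → S) (b : Z → S') (ha : ∀ e z, a (U e z) = T e (a z))
    (hb : ∀ e z, b (U e z) = T' e (b z)) {X : Ω → Path S} {Y : Ω → Path S'}
    (hX : IsMarkovProcess P (jumpMatrix r T) X) (hY : IsMarkovProcess P (jumpMatrix r T') Y)
    (h0 : ∀ᵐ ω ∂P, ∃ z, a z = (X ω).1 0 ∧ b z = (Y ω).1 0)
    {Φ : Path S → ℝ} {Ψ : Path S' → ℝ} (hΦ : Measurable Φ) (hΨ : Measurable Ψ) {C : ℝ}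
    (hΦC : ∀ f, |Φ f| ≤ C) (hΨC : ∀ g, |Ψ g| ≤ C)
    (hle : ∀ (f : Path S) (g : Path S'), (∀ t, ∃ z, a z = f.1 t ∧ b z = g.1 t) → Φ f ≤ Ψ g) :
    ∫ ω, Φ (X ω) ∂P ≤ ∫ ω, Ψ (Y ω) ∂P := by
  classical
  have hX0 : Measurable fun ω => (X ω).1 0 :=
    ((measurable_pi_apply _).comp measurable_subtype_coe).comp hX.measurable
  have hY0 : Measurable fun ω => (Y ω).1 0 :=
    ((measurable_pi_apply _).comp measurable_subtype_coe).comp hY.measurable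
  obtain ⟨ω₀, z₀, -⟩ := h0.exists
  -- a measurable choice of `z` with `(a z, b z) = (X 0, Y 0)`
  set pick : S × S' → Z := fun p => if h : ∃ z, a z = p.1 ∧ b z = p.2 then h.choose else z₀
    with hpick
  have hpick_spec : ∀ p : S × S', (∃ z, a z = p.1 ∧ b z = p.2) →
      a (pick p) = p.1 ∧ b (pick p) = p.2 := by
    intro p hp
    simp only [hpick, dif_pos hp]
    exact hp.choose_spec
  set W : Ω → Z := fun ω => pick ((X ω).1 0, (Y ω).1 0) with hW
  have hWm : Measurable W := (measurable_of_countable pick).comp (hX0.prodMk hY0)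
  have : IsProbabilityMeasure (P.map W) := Measure.isProbabilityMeasure_map hWm.aemeasurable
  set ν : PMF Z := (P.map W).toPMF with hν
  have hνm : ∀ A : Set Z, ν.toOuterMeasure A = P (W ⁻¹' A) := by
    intro A
    have hA : MeasurableSet A := .of_discrete
    rw [← PMF.toMeasure_apply_eq_toOuterMeasure_apply _ hA, hν, Measure.toPMF_toMeasure,
      Measure.map_apply hWm hA]
  have hνX : ∀ s, ν.toOuterMeasure {z | a z = s} = P {ω | (X ω).1 0 = s} := by
    intro s
    rw [hνm]
    refine measure_congr ?_
    filter_upwards [h0] with ω hω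
    exact propext (by
      change a (W ω) = s ↔ (X ω).1 0 = s
      rw [(hpick_spec ((X ω).1 0, (Y ω).1 0) hω).1])
  have hνY : ∀ s, ν.toOuterMeasure {z | b z = s} = P {ω | (Y ω).1 0 = s} := by
    intro s
    rw [hνm]
    refine measure_congr ?_
    filter_upwards [h0] with ω hω
    exact propext (by
      change b (W ω) = s ↔ (Y ω).1 0 = s
      rw [(hpick_spec ((X ω).1 0, (Y ω).1 0) hω).2])
  -- the space of probability measures on the compact space `ℕ × ℕ → Z` is compact
  set F : Ultrafilter (ProbabilityMeasure (ℕ × ℕ → Z)) :=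
    (hyperfilter ℕ).map (gridLaw hr U ν) with hF
  obtain ⟨μ, -, hμ⟩ := isCompact_univ.ultrafilter_le_nhds F (by simp)
  have hμ' : Tendsto (gridLaw hr U ν) (hyperfilter ℕ : Filter ℕ) (𝓝 μ) := hμ
  have hlawX := map_eq_map_sample_of_tendsto hr T U a ha hX ν hνX Nat.hyperfilter_le_atTop hμ'
  have hlawY := map_eq_map_sample_of_tendsto hr T' U b hb hY ν hνY Nat.hyperfilter_le_atTop hμ'
  obtain ⟨φ, hφm, hφ⟩ := Measurable.exists_eq_measurable_comp
    (f := (sample dyadic : Path S → ℕ × ℕ → S)) (g := Φ) (by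
      rw [comap_sample denseRange_dyadic]
      exact hΦ)
  obtain ⟨ψ, hψm, hψ⟩ := Measurable.exists_eq_measurable_comp
    (f := (sample dyadic : Path S' → ℕ × ℕ → S')) (g := Ψ) (by
      rw [comap_sample denseRange_dyadic]
      exact hΨ)
  have hma : Measurable fun (z : ℕ × ℕ → Z) p => a (z p) :=
    measurable_pi_lambda _ fun i => Measurable.of_discrete.comp (measurable_pi_apply _)
  have hmb : Measurable fun (z : ℕ × ℕ → Z) p => b (z p) :=
    measurable_pi_lambda _ fun i => Measurable.of_discrete.comp (measurable_pi_apply _)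
  have hsX : Measurable fun ω => sample dyadic (X ω) := (measurable_sample _).comp hX.measurable
  have hsY : Measurable fun ω => sample dyadic (Y ω) := (measurable_sample _).comp hY.measurable
  have hregX : ∀ᵐ z ∂(μ : Measure (ℕ × ℕ → Z)),
      ∃ f : Path S, sample dyadic f = fun p => a (z p) := by
    have h1 : ∀ᵐ x ∂(P.map fun ω => sample dyadic (X ω)), x ∈ regularSamples S dyadic :=
      (ae_map_iff hsX.aemeasurable measurableSet_regularSamples).2
        (ae_of_all _ fun ω => sample_mem_regularSamples _)
    rw [← hlawX] at h1
    filter_upwards [ae_of_ae_map hma.aemeasurable h1] with z hz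
    exact exists_path_of_mem_regularSamples denseRange_dyadic hz
  have hregY : ∀ᵐ z ∂(μ : Measure (ℕ × ℕ → Z)),
      ∃ g : Path S', sample dyadic g = fun p => b (z p) := by
    have h1 : ∀ᵐ x ∂(P.map fun ω => sample dyadic (Y ω)), x ∈ regularSamples S' dyadic :=
      (ae_map_iff hsY.aemeasurable measurableSet_regularSamples).2
        (ae_of_all _ fun ω => sample_mem_regularSamples _)
    rw [← hlawY] at h1
    filter_upwards [ae_of_ae_map hmb.aemeasurable h1] with z hz
    exact exists_path_of_mem_regularSamples denseRange_dyadic hz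
  have hIX : ∫ ω, Φ (X ω) ∂P = ∫ z, φ (fun p => a (z p)) ∂(μ : Measure (ℕ × ℕ → Z)) := by
    rw [← integral_map hma.aemeasurable hφm.aestronglyMeasurable, hlawX,
      integral_map hsX.aemeasurable hφm.aestronglyMeasurable]
    exact integral_congr_ae (ae_of_all _ fun ω => congrFun hφ (X ω))
  have hIY : ∫ ω, Ψ (Y ω) ∂P = ∫ z, ψ (fun p => b (z p)) ∂(μ : Measure (ℕ × ℕ → Z)) := by
    rw [← integral_map hmb.aemeasurable hψm.aestronglyMeasurable, hlawY,
      integral_map hsY.aemeasurable hψm.aestronglyMeasurable]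
    exact integral_congr_ae (ae_of_all _ fun ω => congrFun hψ (Y ω))
  have hφf : ∀ f, φ (sample dyadic f) = Φ f := fun f => (congrFun hφ f).symm
  have hψg : ∀ g, ψ (sample dyadic g) = Ψ g := fun g => (congrFun hψ g).symm
  rw [hIX, hIY]
  refine integral_mono_ae ?_ ?_ ?_
  · refine Integrable.of_bound (hφm.comp hma).aestronglyMeasurable C ?_
    filter_upwards [hregX] with z ⟨f, hf⟩
    rw [← hf, hφf]
    exact hΦC f
  · refine Integrable.of_bound (hψm.comp hmb).aestronglyMeasurable C ?_
    filter_upwards [hregY] with z ⟨g, hg⟩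
    rw [← hg, hψg]
    exact hΨC g
  · filter_upwards [hregX, hregY] with z ⟨f, hf⟩ ⟨g, hg⟩
    rw [← hf, ← hg, hφf, hψg]
    refine hle f g fun t => ?_
    obtain ⟨ε, hε, h1⟩ := f.2.exists_eq_right t
    obtain ⟨δ, hδ, h2⟩ := g.2.exists_eq_right t
    obtain ⟨p, hp, hpd⟩ := DenseRange.exists_right denseRange_dyadic t (lt_min hε hδ)
    rw [lt_min_iff] at hpd
    refine ⟨z p, ?_, ?_⟩
    · rw [← h1 _ hp.le hpd.1]
      exact (congrFun hf p).symm
    · rw [← h2 _ hp.le hpd.2]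
      exact (congrFun hg p).symm

end Coupling

/-! ### The loss system as a chain driven by events -/

section LossEvents

variable {K : ℕ} {m : Fin K → ℕ} {n : ℕ}

theorem sum_add_unit_one (x : Fin 2 → Fin K → ℕ) (k : Fin K) :
    ∑ l, (x + unit 1 k) 1 l = ∑ l, x 1 l + 1 := by
  simp [unit, Finset.sum_add_distrib, Finset.sum_pi_single']

theorem add_unit_zero_apply (x : Fin 2 → Fin K → ℕ) (k l : Fin K) :
    (x + unit 0 k) 0 l = x 0 l + if l = k then 1 else 0 := by
  simp [unit, Pi.single_apply]

theorem add_unit_one_zero (x : Fin 2 → Fin K → ℕ) (k : Fin K) : (x + unit 1 k) 0 = x 0 := by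
  ext l
  simp [unit]

theorem add_unit_zero_one (x : Fin 2 → Fin K → ℕ) (k : Fin K) : (x + unit 0 k) 1 = x 1 := by
  ext l
  simp [unit]

theorem sub_unit_add_unit {x : Fin 2 → Fin K → ℕ} {i : Fin 2} {k : Fin K} (h : 0 < x i k) :
    x - unit i k + unit i k = x := by
  refine tsub_add_cancel_of_le fun i' k' => ?_
  by_cases hi : i' = i
  · subst hi
    by_cases hk : k' = k
    · subst hk
      simpa [unit] using Nat.succ_le_of_lt h
    · simp [unit, hk]
  · simp [unit, hi]

/-- The state after the arrival of a customer of class `k`. -/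
def arrive (k : Fin K) (x : State m n) : State m n :=
  if h : x.1 0 k < m k then
    ⟨x.1 + unit 0 k, fun l => by
      rw [add_unit_zero_apply]
      split_ifs with hl
      · subst hl
        exact h
      · exact x.2.1 l, by
      rw [add_unit_zero_one]
      exact x.2.2⟩
  else if h : ∑ l, x.1 1 l < n then
    ⟨x.1 + unit 1 k, fun l => by
      rw [add_unit_one_zero]
      exact x.2.1 l, by
      rw [sum_add_unit_one]
      exact h⟩
  else x

/-- The state after the departure of a class-`k` customer from layer `i + 1`; it is the same state
when there is no such customer. -/
def remove (i : Fin 2) (k : Fin K) (x : State m n) : State m n :=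
  ⟨x.1 - unit i k, fun _ => (Nat.sub_le _ _).trans (x.2.1 _),
    (Finset.sum_le_sum fun _ _ => Nat.sub_le _ _).trans x.2.2⟩

theorem remove_add_unit {i : Fin 2} {k : Fin K} {x : State m n} (h : 0 < x.1 i k) :
    (remove i k x).1 + unit i k = x.1 :=
  sub_unit_add_unit h

/-- When `w k` customers of each class `k` are listed class by class, the class of the customer at
position `j`; positions beyond the list get the default value `c`. -/
def classAt (c : Fin K) (w : Fin K → ℕ) (j : ℕ) : Fin K :=
  if h : j < ∑ k, w k then (finSigmaFinEquiv.symm ⟨j, h⟩).1 else c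

theorem classAt_pos (c : Fin K) {w : Fin K → ℕ} {j : ℕ} (h : j < ∑ k, w k) :
    0 < w (classAt c w j) := by
  rw [classAt, dif_pos h]
  exact Fin.pos_iff_nonempty.2 ⟨(finSigmaFinEquiv.symm ⟨j, h⟩).2⟩

theorem sum_range_classAt (c : Fin K) (w : Fin K → ℕ) (g : Fin K → ℝ) :
    ∑ j ∈ Finset.range (∑ k, w k), g (classAt c w j) = ∑ k, w k * g k := by
  rw [← Fin.sum_univ_eq_sum_range fun j => g (classAt c w j)]
  have h : ∀ j : Fin (∑ k, w k), g (classAt c w j) = g (finSigmaFinEquiv.symm j).1 := by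
    intro j
    rw [classAt, dif_pos j.2]
  simp_rw [h]
  rw [Equiv.sum_comp finSigmaFinEquiv.symm fun p : (k : Fin K) × Fin (w k) => g p.1,
    Fintype.sum_sigma]
  simp

/-- The effect of the service completion with label `(k, j)`. For `k ≠ c` it concerns the `j`-th of
the class-`k` customers in layer 1. For `k = c` it concerns the `j`-th customer in the list of the
class-`c` customers in layer 1 followed by the customers in layer 2. Nothing happens if the list is
shorter. -/
def depart (c k : Fin K) (j : ℕ) (x : State m n) : State m n :=
  if j < x.1 0 k then remove 0 k x
  else if k = c ∧ j < x.1 0 k + ∑ l, x.1 1 l then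
    remove 1 (classAt c (x.1 1) (j - x.1 0 k)) x
  else x

/-- The events of the loss system: arrivals, labelled by the class, and service completions,
labelled as in `depart` with positions below `M`. -/
def event (c : Fin K) (M : ℕ) : Fin K ⊕ Fin K × Fin M → State m n → State m n
  | .inl k => arrive k
  | .inr (k, j) => depart c k j

/-- The rates of the events. -/
def eventRate (M : ℕ) (lam mu : Fin K → ℝ) : Fin K ⊕ Fin K × Fin M → ℝ
  | .inl k => lam k
  | .inr (k, _) => mu k

open Classical in
theorem sum_arrival_mul (lam : ℝ) (k : Fin K) (x : State m n) (g : State m n → ℝ) (hg : g x = 0) :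
    ∑ i, ∑ y : State m n,
      (if y.1 = x.1 + unit i k ∧ x ∈ accept m n i k then lam else 0) * g y =
      lam * g (arrive k x) := by
  have h0 : x ∈ accept m n 0 k ↔ x.1 0 k < m k := by simp [accept]
  have h1 : x ∈ accept m n 1 k ↔ x.1 0 k = m k ∧ ∑ l, x.1 1 l < n := by simp [accept]
  have hsum : ∀ (i : Fin 2) (z : State m n), z.1 = x.1 + unit i k → x ∈ accept m n i k →
      ∑ y : State m n, (if y.1 = x.1 + unit i k ∧ x ∈ accept m n i k then lam else 0) * g y =
        lam * g z := by
    intro i z hz hx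
    rw [Finset.sum_eq_single z]
    · rw [if_pos ⟨hz, hx⟩]
    · intro y _ hy
      rw [if_neg fun h => hy (Subtype.ext (h.1.trans hz.symm)), zero_mul]
    · exact fun h => absurd (Finset.mem_univ _) h
  have hzero : ∀ i : Fin 2, x ∉ accept m n i k →
      ∑ y : State m n, (if y.1 = x.1 + unit i k ∧ x ∈ accept m n i k then lam else 0) * g y = 0 := by
    intro i hx
    exact Finset.sum_eq_zero fun y _ => by rw [if_neg fun h => hx h.2, zero_mul]
  rw [Fin.sum_univ_two]
  have hle := x.2.1 k
  by_cases h : x.1 0 k < m k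
  · rw [hsum 0 (arrive k x) (by rw [arrive, dif_pos h]) (h0.2 h),
      hzero 1 (fun h' => (h1.1 h').1.not_lt h), add_zero]
  · by_cases h' : ∑ l, x.1 1 l < n
    · rw [hzero 0 (fun h' => h (h0.1 h')), zero_add,
        hsum 1 (arrive k x) (by rw [arrive, dif_neg h, dif_pos h']) (h1.2 ⟨by omega, h'⟩)]
    · rw [hzero 0 (fun h' => h (h0.1 h')), hzero 1 (fun h'' => h' (h1.1 h'').2), arrive, dif_neg h,
        dif_neg h', hg, mul_zero, add_zero]

open Classical in
theorem sum_departure_mul (mu : ℝ) (i : Fin 2) (k : Fin K) (x : State m n) (g : State m n → ℝ) :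
    ∑ y : State m n, (if x.1 = y.1 + unit i k then mu * (x.1 i k : ℝ) else 0) * g y =
      mu * (x.1 i k * g (remove i k x)) := by
  rcases Nat.eq_zero_or_pos (x.1 i k) with h | h
  · simp [h]
  · rw [Finset.sum_eq_single (remove i k x)]
    · rw [if_pos (remove_add_unit h).symm, mul_assoc]
    · intro y _ hy
      rw [if_neg, zero_mul]
      intro hxy
      exact hy (Subtype.ext (add_right_cancel (hxy.symm.trans (remove_add_unit h).symm)))
    · exact fun h => absurd (Finset.mem_univ _) h

theorem sum_rate_mul (lam mu : Fin K → ℝ) (x : State m n) (g : State m n → ℝ) (hg : g x = 0) :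
    ∑ y, rate m n lam mu x y * g y = ∑ k, lam k * g (arrive k x) +
      (∑ k, mu k * (x.1 0 k * g (remove 0 k x)) + ∑ k, mu k * (x.1 1 k * g (remove 1 k x))) := by
  simp only [rate, Finset.sum_mul, add_mul, Finset.sum_add_distrib]
  congr 1
  · rw [Finset.sum_comm]
    simp_rw [Finset.sum_comm (s := (Finset.univ : Finset (State m n)))]
    rw [Finset.sum_comm]
    exact Finset.sum_congr rfl fun k _ => sum_arrival_mul (lam k) k x g hg
  · rw [Finset.sum_comm]
    simp_rw [Finset.sum_comm (s := (Finset.univ : Finset (State m n))), sum_departure_mul]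
    rw [Fin.sum_univ_two]

theorem sum_depart (c k : Fin K) {M : ℕ} (x : State m n) (g : State m n → ℝ) (hg : g x = 0)
    (hM : x.1 0 k + (if k = c then ∑ l, x.1 1 l else 0) ≤ M) :
    ∑ j : Fin M, g (depart c k j x) = x.1 0 k * g (remove 0 k x) +
      if k = c then ∑ l, x.1 1 l * g (remove 1 l x) else 0 := by
  rw [Fin.sum_univ_eq_sum_range fun j => g (depart c k j x)]
  obtain ⟨N, hN⟩ := Nat.exists_eq_add_of_le hM
  rw [hN, Finset.sum_range_add, Finset.sum_range_add]
  have h1 : ∑ j ∈ Finset.range (x.1 0 k), g (depart c k j x) = x.1 0 k * g (remove 0 k x) := by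
    rw [Finset.sum_congr rfl fun j hj => by rw [depart, if_pos (Finset.mem_range.1 hj)]]
    simp
  have h3 : ∑ j ∈ Finset.range N, g (depart c k
      (x.1 0 k + (if k = c then ∑ l, x.1 1 l else 0) + j) x) = 0 := by
    refine Finset.sum_eq_zero fun j _ => ?_
    rw [depart, if_neg (by omega), if_neg, hg]
    rintro ⟨hk, hj⟩
    rw [if_pos hk] at hj
    omega
  rw [h1, h3, add_zero]
  congr 1
  split_ifs with hk
  · rw [← sum_range_classAt c (x.1 1) fun l => g (remove 1 l x)]
    refine Finset.sum_congr rfl fun j hj => ?_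
    have hj' := Finset.mem_range.1 hj
    rw [depart, if_neg (by omega), if_pos ⟨hk, by omega⟩, Nat.add_sub_cancel_left]
  · simp

/-- As all service rates are equal, the customers in layer 2 may be served in the order in which
`depart` lists them. -/
theorem generator_rate_eq_jumpMatrix (c : Fin K) {M : ℕ} (lam mu : Fin K → ℝ)
    (hmu : ∀ k l, mu k = mu l) (hM : ∀ k, m k + (if k = c then n else 0) ≤ M) :
    generator (rate m n lam mu) = jumpMatrix (eventRate M lam mu) (event c M) := by
  ext x y
  have key : ∀ g : State m n → ℝ, g x = 0 → ∑ z, rate m n lam mu x z * g z =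
      ∑ e, eventRate M lam mu e * g (event c M e x) := by
    intro g hg
    rw [sum_rate_mul lam mu x g hg, Fintype.sum_sum_type, Fintype.sum_prod_type]
    simp only [event, eventRate]
    congr 1
    have h : ∀ k, ∑ j : Fin M, mu k * g (depart c k j x) = mu k * (x.1 0 k * g (remove 0 k x)) +
        if k = c then ∑ l, mu l * (x.1 1 l * g (remove 1 l x)) else 0 := by
      intro k
      rw [← Finset.mul_sum, sum_depart c k x g hg, mul_add, mul_ite, mul_zero, Finset.mul_sum]
      · simp only [fun l => hmu l k]
      · refine le_trans (add_le_add (x.2.1 k) ?_) (hM k)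
        split_ifs
        · exact x.2.2
        · exact le_rfl
    rw [Finset.sum_congr rfl fun k _ => h k, Finset.sum_add_distrib]
    simp
  have h := key (fun z => (if z = y then 1 else 0) - if x = y then 1 else 0) (sub_self _)
  simp only [generator, jumpMatrix, Matrix.of_apply]
  rw [← h]
  simp only [mul_sub, Finset.sum_sub_distrib, mul_ite, mul_one, mul_zero, Finset.sum_ite_eq',
    Finset.mem_univ, if_true]
  split_ifs <;> simp

theorem arrive_zero (k l : Fin K) (x : State m n) :
    (arrive k x).1 0 l = if l = k ∧ x.1 0 k < m k then x.1 0 l + 1 else x.1 0 l := by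
  by_cases h : x.1 0 k < m k
  · rw [arrive, dif_pos h]
    refine (add_unit_zero_apply _ _ _).trans ?_
    simp only [h, and_true]
    split_ifs <;> rfl
  · rw [arrive, dif_neg h, if_neg fun h' => h h'.2]
    split_ifs
    · exact congrFun (add_unit_one_zero _ _) l
    · rfl

theorem sum_arrive_one (k : Fin K) (x : State m n) :
    ∑ l, (arrive k x).1 1 l =
      if ¬x.1 0 k < m k ∧ ∑ l, x.1 1 l < n then ∑ l, x.1 1 l + 1 else ∑ l, x.1 1 l := by
  by_cases h : x.1 0 k < m k
  · rw [arrive, dif_pos h, if_neg fun h' => h'.1 h]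
    exact congrArg (fun w => ∑ l, w l) (add_unit_zero_one x.1 k)
  · rw [arrive, dif_neg h]
    by_cases h' : ∑ l, x.1 1 l < n
    · rw [dif_pos h', if_pos ⟨h, h'⟩]
      exact sum_add_unit_one x.1 k
    · rw [dif_neg h', if_neg fun h'' => h' h''.2]

theorem depart_zero (c k l : Fin K) (j : ℕ) (x : State m n) :
    (depart c k j x).1 0 l = if l = k ∧ j < x.1 0 k then x.1 0 l - 1 else x.1 0 l := by
  by_cases h : j < x.1 0 k
  · have h1 := add_unit_zero_apply (remove 0 k x).1 k l
    rw [remove_add_unit (by omega)] at h1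
    rw [depart, if_pos h]
    split_ifs at h1 ⊢ <;> grind
  · rw [if_neg (c := l = k ∧ j < x.1 0 k) fun h' => h h'.2, depart, if_neg h]
    split_ifs with h'
    · have hp := classAt_pos c (w := x.1 1) (j := j - x.1 0 k) (by omega)
      have h1 := add_unit_one_zero (remove 1 (classAt c (x.1 1) (j - x.1 0 k)) x).1
        (classAt c (x.1 1) (j - x.1 0 k))
      rw [remove_add_unit hp] at h1
      exact (congrFun h1 l).symm
    · rfl

theorem sum_depart_one (c k : Fin K) (j : ℕ) (x : State m n) :
    ∑ l, (depart c k j x).1 1 l =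
      if k = c ∧ ¬j < x.1 0 k ∧ j < x.1 0 k + ∑ l, x.1 1 l then ∑ l, x.1 1 l - 1
      else ∑ l, x.1 1 l := by
  by_cases h : j < x.1 0 k
  · have h1 := add_unit_zero_one (remove 0 k x).1 k
    rw [remove_add_unit (by omega)] at h1
    rw [depart, if_pos h, if_neg fun h' => h'.2.1 h, h1]
  · rw [depart, if_neg h]
    by_cases h' : k = c ∧ j < x.1 0 k + ∑ l, x.1 1 l
    · have hp := classAt_pos c (w := x.1 1) (j := j - x.1 0 k) (by omega)
      have h1 := sum_add_unit_one (remove 1 (classAt c (x.1 1) (j - x.1 0 k)) x).1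
        (classAt c (x.1 1) (j - x.1 0 k))
      rw [remove_add_unit hp] at h1
      rw [if_pos h', if_pos ⟨h'.1, h, h'.2⟩]
      omega
    · rw [if_neg h', if_neg fun h'' => h' ⟨h''.1, h''.2.2⟩]

end LossEvents

/-! ### The relation between the two systems -/

section Relation

variable {K : ℕ} {m m' : Fin K → ℕ} {n n' : ℕ}

theorem aggregate_sub_mem_Delta_iff (c : Fin K) (x : State m n) (y : State m' n') :
    aggregate y - aggregate x ∈ Delta c ↔ (∀ k, k ≠ c → y.1 0 k = x.1 0 k) ∧
      ((y.1 0 c = x.1 0 c ∧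
          (∑ k, y.1 1 k = ∑ k, x.1 1 k ∨ ∑ k, y.1 1 k = ∑ k, x.1 1 k + 1)) ∨
        (y.1 0 c + 1 = x.1 0 c ∧
          (∑ k, y.1 1 k = ∑ k, x.1 1 k + 1 ∨ ∑ k, y.1 1 k = ∑ k, x.1 1 k + 2))) := by
  have hfst : ∀ d : ℤ, (fun k => (y.1 0 k : ℤ)) - (fun k => (x.1 0 k : ℤ)) = Pi.single c d ↔
      (∀ k, k ≠ c → y.1 0 k = x.1 0 k) ∧ (y.1 0 c : ℤ) - x.1 0 c = d := by
    intro d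
    rw [funext_iff]
    constructor
    · intro h
      refine ⟨fun k hk => ?_, ?_⟩
      · have := h k
        simp only [Pi.sub_apply, Pi.single_eq_of_ne hk] at this
        omega
      · simpa using h c
    · rintro ⟨h1, h2⟩ k
      by_cases hk : k = c
      · subst hk
        simpa using h2
      · simp [hk, h1 k hk]
  have hneg : -(Pi.single c 1 : Fin K → ℤ) = Pi.single c (-1) := (Pi.single_neg c 1).symm
  have hzero : (0 : Fin K → ℤ) = Pi.single c 0 := (Pi.single_zero c).symm
  simp only [Delta, aggregate, Set.mem_insert_iff, Set.mem_singleton_iff, Prod.ext_iff,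
    Prod.fst_sub, Prod.snd_sub, Prod.fst_zero, Prod.snd_zero, Prod.smul_fst, Prod.smul_snd,
    smul_zero, zero_sub, sub_zero, hneg, ← Nat.cast_sum]
  rw [hzero]
  simp only [hfst, nsmul_eq_mul, Nat.cast_ofNat, mul_one]
  constructor
  · rintro (⟨⟨h, h1⟩, h2⟩ | ⟨⟨h, h1⟩, h2⟩ | ⟨⟨h, h1⟩, h2⟩ | ⟨⟨h, h1⟩, h2⟩) <;>
      refine ⟨h, ?_⟩ <;> omega
  · rintro ⟨h, ⟨h1, h2 | h2⟩ | ⟨h1, h2 | h2⟩⟩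
    · exact Or.inl ⟨⟨h, by omega⟩, by omega⟩
    · exact Or.inr (Or.inl ⟨⟨h, by omega⟩, by omega⟩)
    · exact Or.inr (Or.inr (Or.inl ⟨⟨h, by omega⟩, by omega⟩))
    · exact Or.inr (Or.inr (Or.inr ⟨⟨h, by omega⟩, by omega⟩))

theorem total_le_of_mem_Delta (c : Fin K) (x : State m n) (y : State m' n')
    (h : aggregate y - aggregate x ∈ Delta c) : total x ≤ total y := by
  obtain ⟨h0, h1⟩ := (aggregate_sub_mem_Delta_iff c x y).1 h
  have he : ∑ k ∈ Finset.univ.erase c, y.1 0 k = ∑ k ∈ Finset.univ.erase c, x.1 0 k :=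
    Finset.sum_congr rfl fun k hk => h0 k (Finset.ne_of_mem_erase hk)
  have hx := Finset.add_sum_erase Finset.univ (x.1 0) (Finset.mem_univ c)
  have hy := Finset.add_sum_erase Finset.univ (y.1 0) (Finset.mem_univ c)
  simp only [total, Fin.sum_univ_two]
  omega

theorem arrive_mem_Delta (c : Fin K) (hm : 1 ≤ m c) (k : Fin K) (x : State m n)
    (y : State (Function.update m c (m c - 1)) (n + 1))
    (h : aggregate y - aggregate x ∈ Delta c) :
    aggregate (arrive k y) - aggregate (arrive k x) ∈ Delta c := by
  rw [aggregate_sub_mem_Delta_iff] at h ⊢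
  obtain ⟨h0, h1⟩ := h
  have hxn := x.2.2
  have hyn := y.2.2
  have hxc := x.2.1 c
  have hyc := y.2.1 c
  have hxk := x.2.1 k
  simp only [arrive_zero, sum_arrive_one]
  rw [Function.update_self] at hyc
  by_cases hk : k = c
  · subst hk
    rw [Function.update_self]
    refine ⟨fun l hl => by simp [hl, h0 l hl], ?_⟩
    simp only [true_and]
    split_ifs <;> omega
  · rw [Function.update_of_ne hk]
    have hkk := h0 k hk
    refine ⟨fun l hl => by simp only [h0 l hl, hkk], ?_⟩
    have hck : c ≠ k := fun h => hk h.symm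
    simp only [hck, false_and, if_false, hkk]
    split_ifs <;> omega

theorem depart_mem_Delta (c k : Fin K) (j : ℕ) (x : State m n) (y : State m' n')
    (h : aggregate y - aggregate x ∈ Delta c) :
    aggregate (depart c k j y) - aggregate (depart c k j x) ∈ Delta c := by
  rw [aggregate_sub_mem_Delta_iff] at h ⊢
  obtain ⟨h0, h1⟩ := h
  simp only [depart_zero, sum_depart_one]
  by_cases hk : k = c
  · subst hk
    refine ⟨fun l hl => by simp [hl, h0 l hl], ?_⟩
    simp only [true_and]
    split_ifs <;> omega
  · have hkk := h0 k hk
    refine ⟨fun l hl => by simp only [h0 l hl, hkk], ?_⟩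
    have hck : c ≠ k := fun h => hk h.symm
    simpa only [hck, hk, false_and, if_false] using h1

end Relation

end LossSystem

theorem theorem3 {Ω : Type*} [MeasurableSpace Ω] (P : MeasureTheory.Measure Ω)
    [MeasureTheory.IsProbabilityMeasure P] {K : ℕ} (c : Fin K) (m : Fin K → ℕ) (n : ℕ)
    (hm : 1 ≤ m c) (lam mu : Fin K → ℝ) (hlam : ∀ k, 0 < lam k) (hmu : ∀ k, 0 < mu k)
    (hmu_eq : ∀ k l, mu k = mu l)
    (X : Ω → LossSystem.Path (LossSystem.State m n))
    (hX : LossSystem.IsLossProcess P m n lam mu X)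
    (Y : Ω → LossSystem.Path (LossSystem.State (Function.update m c (m c - 1)) (n + 1)))
    (hY : LossSystem.IsLossProcess P (Function.update m c (m c - 1)) (n + 1) lam mu Y)
    (h0 : ∀ᵐ ω ∂P, LossSystem.aggregate ((Y ω).1 0) - LossSystem.aggregate ((X ω).1 0) ∈
      LossSystem.Delta c) :
    LossSystem.StochLE P (fun ω => LossSystem.totalPath (X ω))
      P (fun ω => LossSystem.totalPath (Y ω)) := by
  classical
  rintro φ hφ ⟨C, hC⟩ hmono
  -- enough positions for the longest list of customers in either system
  set M : ℕ := ∑ k, m k + n with hM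
  have hle : ∀ k, m k ≤ ∑ k, m k := fun k =>
    Finset.single_le_sum (fun _ _ => Nat.zero_le _) (Finset.mem_univ k)
  have hMX : ∀ k, m k + (if k = c then n else 0) ≤ M := by
    intro k
    have := hle k
    split_ifs <;> omega
  have hMY : ∀ k, Function.update m c (m c - 1) k + (if k = c then n + 1 else 0) ≤ M := by
    intro k
    have := hle k
    by_cases hk : k = c
    · subst hk
      rw [Function.update_self, if_pos rfl]
      omega
    · rw [Function.update_of_ne hk, if_neg hk]
      omega
  rw [LossSystem.IsLossProcess, LossSystem.generator_rate_eq_jumpMatrix c lam mu hmu_eq hMX] at hX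
  rw [LossSystem.IsLossProcess, LossSystem.generator_rate_eq_jumpMatrix c lam mu hmu_eq hMY] at hY
  let Z := {p : LossSystem.State m n ×
    LossSystem.State (Function.update m c (m c - 1)) (n + 1) //
      LossSystem.aggregate p.2 - LossSystem.aggregate p.1 ∈ LossSystem.Delta c}
  let U : Fin K ⊕ Fin K × Fin M → Z → Z := fun e z =>
    ⟨(LossSystem.event c M e z.1.1, LossSystem.event c M e z.1.2), by
      rcases e with k | ⟨k, j⟩
      · exact LossSystem.arrive_mem_Delta c hm k _ _ z.2
      · exact LossSystem.depart_mem_Delta c k j _ _ z.2⟩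
  have hmeas : ∀ (m : Fin K → ℕ) (n : ℕ), Measurable
      (LossSystem.totalPath : LossSystem.Path (LossSystem.State m n) → LossSystem.Path ℕ) := by
    intro m n
    refine Measurable.subtype_mk (measurable_pi_lambda _ fun t => ?_)
    have h : Measurable fun f : LossSystem.Path (LossSystem.State m n) => f.1 t :=
      (measurable_pi_apply t).comp measurable_subtype_coe
    exact (Measurable.of_discrete (f := LossSystem.total)).comp h
  refine LossSystem.integral_le_of_equivariant (r := LossSystem.eventRate M lam mu) ?_
    (LossSystem.event c M) (LossSystem.event c M) U (fun z => z.1.1) (fun z => z.1.2)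
    (fun _ _ => rfl) (fun _ _ => rfl) hX hY ?_ (hφ.comp (hmeas _ _)) (hφ.comp (hmeas _ _))
    (fun f => hC _) (fun g => hC _) ?_
  · rintro (k | ⟨k, j⟩)
    · exact (hlam k).le
    · exact (hmu k).le
  · filter_upwards [h0] with ω hω
    exact ⟨⟨(_, _), hω⟩, rfl, rfl⟩
  · intro f g hfg
    refine hmono fun t => ?_
    obtain ⟨z, hz1, hz2⟩ := hfg t
    have := LossSystem.total_le_of_mem_Delta c z.1.1 z.1.2 z.2
    rw [hz1, hz2] at this
    exact this
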